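/- Let $d\in\{2,3\}$ and $N\in\{1,2\}$. Let $\Lambda\subset\mathbb{R}^d$ be a (full-rank) lattice with bounded unit cell $Y$, let $\Lambda^*=\{q: q\cdot n\in2\pi\mathbb{Z}\ \forall n\in\Lambda\}$ be its dual lattice and $Y^*=\mathbb{R}^d/\Lambda^*$ the Brillouin zone. Let $D_1,\dots,D_N$ be connected nonempty open sets with boundaries of class $C^{1,s}$, $0<s<1$, with pairwise disjoint closures contained in the interior of $Y$ (the resonators), and put $\partial D=\bigcup_i\partial D_i$. For $\alpha\in Y^*$, $\alpha\neq0$, let $G^{\alpha}(x,y)$ be the $\alpha$-quasiperiodic Green's function of the Laplace operator, i.e. $G^\alpha(x,y)=g^\alpha(x-y)$ where $g^\alpha(x+n)=e^{\mathrm{i}\alpha\cdot n}g^\alpha(x)$ for $n\in\Lambda$ and $\Delta g^\alpha=\sum_{n\in\Lambda}e^{\mathrm{i}\alpha\cdot n}\delta_n$. Let $\mathcal{S}^\alpha[\varphi](x)=\int_{\partial D}G^\alpha(x,y)\varphi(y)\,\mathrm{d}\sigma(y)$ be the single layer potential on $L^2(\partial D)$, let $\psi_j^\alpha=(\mathcal{S}^\alpha)^{-1}[\chi_{\partial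 D_j}]$, and let $C^\alpha=(C^\alpha_{ij})$, $C^\alpha_{ij}=-\int_{\partial D_i}\psi_j^\alpha\,\mathrm{d}\sigma$, be the capacitance matrix (at $\alpha=0$, where these formulas do not define it, $C^0$ is set to $0$; since $-0=0$ the claim is trivial there). Let $\rho_0,\rho_r,\kappa_r>0$, $\delta=\rho_r/\rho_0$, $T>0$, and for $i=1,\dots,N$ let $\rho_i\in C^0(\mathbb{R})$ and $\kappa_i\in C^1(\mathbb{R})$ be positive $T$-periodic functions, with $\kappa_i'$ differentiable. Define $$M^\alpha(t)=\frac{\delta\kappa_r}{\rho_r}W_1(t)C^\alpha W_2(t)+W_3(t),$$ where $W_1,W_2,W_3$ are the diagonal matrices with entries $$(W_1)_{ii}=\frac{\sqrt{\kappa_i}\,\rho_i}{|D_i|},\qquad (W_2)_{ii}=\frac{\sqrt{\kappa_i}}{\rho_i},\qquad (W_3)_{ii}=\frac{\sqrt{\kappa_i}}{2}\,\frac{\mathrm{d}}{\mathrm{d}t}\frac{\mathrm{d}\kappa_i/\mathrm{d}t}{\kappa_i^{3/2}}.$$ A quasifrequency at $\alpha$ is an $\omega\in\mathbb{C}/(\tfrac{2\pi}{T}\mathbb{Z})$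 for which the ODE $$\frac{\mathrm{d}^2\phi}{\mathrm{d}t^2}(t)+M^\alpha(t)\phi(t)=0,\qquad t\in\mathbb{R},$$ has a nonzero solution $\phi:\mathbb{R}\to\mathbb{C}^N$ with $\phi(t+T)=e^{\mathrm{i}\omega T}\phi(t)$ for all $t$. Then the ODE is reciprocal: for every $\alpha\in Y^*$, the set of quasifrequencies at $\alpha$ coincides with the set of quasifrequencies at $-\alpha$. -/

import Mathlib

open MeasureTheory
open scoped NNReal ContDiff

noncomputable section

namespace SpaceTimeResonators

/-! ### Resonator geometry -/

/-- `U` has a boundary of Hölder class `C^{1,s}`: near each boundary point, in suitable orthogonal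
coordinates (`ν` being the last coordinate direction), `U` is the set of points lying below the
graph of a `C¹` function `γ` with `s`-Hölder continuous derivative. -/
def HasC1HolderBoundary {d : ℕ} (s : ℝ≥0) (U : Set (EuclideanSpace ℝ (Fin d))) : Prop :=
  ∀ p ∈ frontier U, ∃ ν : EuclideanSpace ℝ (Fin d), ‖ν‖ = 1 ∧
    ∃ γ : (Submodule.span ℝ {ν})ᗮ → ℝ, ContDiff ℝ 1 γ ∧
      (∃ K : ℝ≥0, HolderWith K s (fderiv ℝ γ)) ∧
      ∃ r : ℝ, 0 < r ∧ ∀ x ∈ Metric.ball p r,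
        x ∈ U ↔ inner ℝ ν x < γ ((Submodule.span ℝ {ν})ᗮ.orthogonalProjectionOnto x)

/-- A fully periodic structure in `ℝ^d` with `N` resonators `D i` compactly contained in the
unit cell `Y` of the lattice `Λ`. -/
structure ResonatorStructure (d N : ℕ) where
  Λ : Submodule ℤ (EuclideanSpace ℝ (Fin d))
  discrete : DiscreteTopology Λ
  isZLattice : IsZLattice ℝ Λ
  Y : Set (EuclideanSpace ℝ (Fin d))
  Y_bounded : Bornology.IsBounded Y
  Y_unitCell : IsAddFundamentalDomain Λ Y volume
  D : Fin N → Set (EuclideanSpace ℝ (Fin d))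
  D_open : ∀ i, IsOpen (D i)
  D_connected : ∀ i, IsConnected (D i)
  D_compactlyContained : ∀ i, closure (D i) ⊆ interior Y
  D_disjoint : Pairwise fun i j => Disjoint (closure (D i)) (closure (D j))
  s : ℝ≥0
  s_pos : 0 < s
  s_lt_one : s < 1
  D_boundary : ∀ i, HasC1HolderBoundary s (D i)

/-- The dual lattice `Λ* = {q | q · n ∈ 2πℤ for all n ∈ Λ}`. -/
def dualLattice {d : ℕ} (Λ : Submodule ℤ (EuclideanSpace ℝ (Fin d))) :
    AddSubgroup (EuclideanSpace ℝ (Fin d)) where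
  carrier := {q | ∀ n ∈ Λ, ∃ m : ℤ, inner ℝ q n = 2 * Real.pi * m}
  zero_mem' := fun n _ => ⟨0, by simp⟩
  add_mem' := by
    intro a b ha hb n hn
    obtain ⟨k, hk⟩ := ha n hn
    obtain ⟨l, hl⟩ := hb n hn
    exact ⟨k + l, by rw [inner_add_left, hk, hl]; push_cast; ring⟩
  neg_mem' := by
    intro a ha n hn
    obtain ⟨k, hk⟩ := ha n hn
    exact ⟨-k, by rw [inner_neg_left, hk]; push_cast; ring⟩

/-- The space Brillouin zone `Y* = ℝ^d / Λ*`. -/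
abbrev BrillouinZone {d : ℕ} (Λ : Submodule ℤ (EuclideanSpace ℝ (Fin d))) : Type :=
  EuclideanSpace ℝ (Fin d) ⧸ dualLattice Λ

/-! ### Quasiperiodic Green's function and the capacitance matrix -/

/-- The fundamental solution of the Laplace operator in `ℝ²` and in `ℝ³`. -/
def laplaceFundamentalSolution (d : ℕ) (x : EuclideanSpace ℝ (Fin d)) : ℝ :=
  if d = 2 then Real.log ‖x‖ / (2 * Real.pi) else -1 / (4 * Real.pi * ‖x‖)

/-- `x ↦ g (x - y)` is the `α`-quasiperiodic Green's function `G^{α,0}(x, y)` of the Laplace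
operator: `g` is `α`-quasiperiodic, satisfies `Δ g = ∑_{n ∈ Λ} e^{i α·n} δ_n` in the sense of
distributions, and is taken in its representative that is continuous away from `Λ`, with the
logarithmic or Newtonian singularity at the origin.
For `α ∉ Λ*` this determines `g` uniquely off `Λ`. -/
structure IsQuasiperiodicGreen {d : ℕ} (Λ : Submodule ℤ (EuclideanSpace ℝ (Fin d)))
    (α : EuclideanSpace ℝ (Fin d)) (g : EuclideanSpace ℝ (Fin d) → ℂ) : Prop where
  quasiperiodic : ∀ n ∈ Λ, ∀ x,
    g (x + n) = Complex.exp (Complex.I * ((inner ℝ α n : ℝ) : ℂ)) * g x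
  continuousOn : ContinuousOn g {x | x ∉ Λ}
  locallyIntegrable : LocallyIntegrable g volume
  equation : ∀ φ : EuclideanSpace ℝ (Fin d) → ℂ, ContDiff ℝ ∞ φ → HasCompactSupport φ →
    ∫ x, g x * Laplacian.laplacian φ x =
      ∑' n : Λ, Complex.exp (Complex.I * ((inner ℝ α (n : EuclideanSpace ℝ (Fin d)) : ℝ) : ℂ)) *
        φ (n : EuclideanSpace ℝ (Fin d))
  singularity : ∃ K r : ℝ, 0 < r ∧ ∀ x, 0 < ‖x‖ → ‖x‖ < r →
    ‖g x - ((laplaceFundamentalSolution d x : ℝ) : ℂ)‖ ≤ K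

namespace ResonatorStructure

variable {d N : ℕ}

/-- The boundary `∂D` of the system `D = ⋃ᵢ Dᵢ` of resonators in the unit cell. -/
def boundary (R : ResonatorStructure d N) : Set (EuclideanSpace ℝ (Fin d)) :=
  ⋃ i, frontier (R.D i)

/-- The `(d-1)`-dimensional surface measure. -/
def surfaceMeasure (d : ℕ) : Measure (EuclideanSpace ℝ (Fin d)) :=
  Measure.euclideanHausdorffMeasure (d - 1)

/-- The (trace on `∂D` of the) single layer potential
`S[φ](x) = ∫_{∂D} G(x, y) φ(y) dσ(y)` with kernel `G(x, y) = g (x - y)`. -/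
def singleLayer (R : ResonatorStructure d N) (g φ : EuclideanSpace ℝ (Fin d) → ℂ)
    (x : EuclideanSpace ℝ (Fin d)) : ℂ :=
  ∫ y in R.boundary, g (x - y) * φ y ∂(surfaceMeasure d)

/-- `ψ = S⁻¹[χ_{∂Dᵢ}]`: the density `ψ` is in `L²(∂D)` and its single layer potential equals
the characteristic function of `∂Dᵢ` on `∂D`. -/
def IsBasisDensity (R : ResonatorStructure d N) (g : EuclideanSpace ℝ (Fin d) → ℂ) (i : Fin N)
    (ψ : EuclideanSpace ℝ (Fin d) → ℂ) : Prop :=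
  MemLp ψ 2 ((surfaceMeasure d).restrict R.boundary) ∧
    ∀ᵐ x ∂((surfaceMeasure d).restrict R.boundary),
      R.singleLayer g ψ x = (frontier (R.D i)).indicator (fun _ => (1 : ℂ)) x

/-- `C` is the capacitance matrix at the quasiperiodicity `a ∈ Y*`:
`C i j = -∫_{∂Dᵢ} ψⱼ dσ` with `ψⱼ = (S^{α,0})⁻¹[χ_{∂Dⱼ}]`, `α` being a representative of `a`. -/
def IsCapacitanceMatrix (R : ResonatorStructure d N) (a : BrillouinZone R.Λ)
    (C : Matrix (Fin N) (Fin N) ℂ) : Prop :=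
  ∃ α : EuclideanSpace ℝ (Fin d), (QuotientAddGroup.mk α : BrillouinZone R.Λ) = a ∧
    ∃ g : EuclideanSpace ℝ (Fin d) → ℂ, IsQuasiperiodicGreen R.Λ α g ∧
      ∃ ψ : Fin N → EuclideanSpace ℝ (Fin d) → ℂ, (∀ j, R.IsBasisDensity g j (ψ j)) ∧
        ∀ i j, C i j = -∫ x in frontier (R.D i), ψ j x ∂(surfaceMeasure d)

open Classical in
/-- The capacitance matrix `C^α`, `α ∈ Y*`. It is defined by the boundary integral equations for
`α ≠ 0` (where the single layer potential is invertible); at `α = 0`, where there is no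
quasiperiodic Green's function, it is given the conventional value `0`. -/
def capacitanceMatrix (R : ResonatorStructure d N) (a : BrillouinZone R.Λ) :
    Matrix (Fin N) (Fin N) ℂ :=
  if h : ∃ C, R.IsCapacitanceMatrix a C then h.choose else 0

end ResonatorStructure

/-! ### Material parameters and time modulation -/

/-- The constant material parameters of the background (`ρ₀`, `κ₀`) and of the resonators
(`ρr`, `κr`). -/
structure MaterialConstants where
  ρ₀ : ℝ
  κ₀ : ℝ
  ρr : ℝ
  κr : ℝ
  ρ₀_pos : 0 < ρ₀
  κ₀_pos : 0 < κ₀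
  ρr_pos : 0 < ρr
  κr_pos : 0 < κr

/-- The contrast `δ = ρr / ρ₀`. -/
def MaterialConstants.δ (P : MaterialConstants) : ℝ := P.ρr / P.ρ₀

/-- `T`-periodic modulations `ρ i` (of class `C⁰`) and `κ i` (of class `C¹`) of the density and of
the bulk modulus inside the resonators. The derivative of `κ i` is differentiable, so that the
coefficients of the ODE make sense. -/
structure TimeModulation (N : ℕ) where
  T : ℝ
  T_pos : 0 < T
  ρ : Fin N → ℝ → ℝ
  κ : Fin N → ℝ → ℝ
  ρ_pos : ∀ i t, 0 < ρ i t
  κ_pos : ∀ i t, 0 < κ i t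
  ρ_continuous : ∀ i, Continuous (ρ i)
  κ_contDiff : ∀ i, ContDiff ℝ 1 (κ i)
  κ_deriv_differentiable : ∀ i, Differentiable ℝ (deriv (κ i))
  ρ_periodic : ∀ i, Function.Periodic (ρ i) T
  κ_periodic : ∀ i, Function.Periodic (κ i) T

variable {d N : ℕ}

/-- `(W₁)ᵢᵢ = √κᵢ ρᵢ / |Dᵢ|`. -/
def W₁ (R : ResonatorStructure d N) (m : TimeModulation N) (t : ℝ) : Matrix (Fin N) (Fin N) ℂ :=
  Matrix.diagonal fun i =>
    ((Real.sqrt (m.κ i t) * m.ρ i t / (volume (R.D i)).toReal : ℝ) : ℂ)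

/-- `(W₂)ᵢᵢ = √κᵢ / ρᵢ`. -/
def W₂ (m : TimeModulation N) (t : ℝ) : Matrix (Fin N) (Fin N) ℂ :=
  Matrix.diagonal fun i => ((Real.sqrt (m.κ i t) / m.ρ i t : ℝ) : ℂ)

/-- `(W₃)ᵢᵢ = (√κᵢ / 2) d/dt (κᵢ' / κᵢ^{3/2})`. -/
def W₃ (m : TimeModulation N) (t : ℝ) : Matrix (Fin N) (Fin N) ℂ :=
  Matrix.diagonal fun i =>
    ((Real.sqrt (m.κ i t) / 2 *
      deriv (fun τ => deriv (m.κ i) τ / (m.κ i τ) ^ (3 / 2 : ℝ)) t : ℝ) : ℂ)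

/-- `M^α(t) = (δ κr / ρr) W₁(t) C^α W₂(t) + W₃(t)`. -/
def hillMatrix (R : ResonatorStructure d N) (P : MaterialConstants) (m : TimeModulation N)
    (a : BrillouinZone R.Λ) (t : ℝ) : Matrix (Fin N) (Fin N) ℂ :=
  ((P.δ * P.κr / P.ρr : ℝ) : ℂ) • (W₁ R m t * R.capacitanceMatrix a * W₂ m t) + W₃ m t

/-! ### Quasifrequencies and reciprocity -/

/-- The time Brillouin zone `Yₜ* = ℂ / Ωℤ`, `Ω = 2π / T`. -/
abbrev TimeBrillouinZone (T : ℝ) : Type :=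
  ℂ ⧸ AddSubgroup.zmultiples ((2 * Real.pi / T : ℝ) : ℂ)

/-- `φ` solves `φ'' + M φ = 0` on `ℝ`. -/
def IsHillSolution (M : ℝ → Matrix (Fin N) (Fin N) ℂ) (φ : ℝ → Fin N → ℂ) : Prop :=
  Differentiable ℝ φ ∧ Differentiable ℝ (deriv φ) ∧
    ∀ t, deriv (deriv φ) t + (M t).mulVec (φ t) = 0

/-- The set of quasifrequencies `ν ∈ Yₜ*` of `φ'' + M φ = 0`: those for which there is a nonzero
solution with `φ (t + T) = e^{i ν T} φ t`. -/
def quasifrequencies (T : ℝ) (M : ℝ → Matrix (Fin N) (Fin N) ℂ) : Set (TimeBrillouinZone T) :=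
  {w | ∃ ν : ℂ, (QuotientAddGroup.mk ν : TimeBrillouinZone T) = w ∧
    ∃ φ : ℝ → Fin N → ℂ, φ ≠ 0 ∧ IsHillSolution M φ ∧
      ∀ t, φ (t + T) = Complex.exp (Complex.I * ν * (T : ℂ)) • φ t}

/-- Reciprocity of the ODE `φ'' + M^α φ = 0`: for every `α ∈ Y*`, the set of quasifrequencies at
`α` coincides with the set of quasifrequencies at `-α`. -/
def Reciprocal (R : ResonatorStructure d N) (P : MaterialConstants) (m : TimeModulation N) : Prop :=
  ∀ a : BrillouinZone R.Λ,
    quasifrequencies m.T (hillMatrix R P m a) = quasifrequencies m.T (hillMatrix R P m (-a))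

end SpaceTimeResonators

end

/-! Passing from `α` to `-α` transposes the capacitance matrix. If `g` is a Green's function at `α`,
then `z ↦ g (-z)` is one at `-α`, so the kernel of the single layer potential at `-α` is the
transposed kernel. Pairing the two families of densities and applying Fubini gives `C^{-α} =
(C^α)ᵀ`. Conjugating all data gives a capacitance matrix at `-α` as well, so `C^α` is also
Hermitian.

A Hermitian matrix of size at most two is carried to its transpose by a constant diagonal
conjugation, because a single off-diagonal phase can always be gauged away. This conjugation
commutes with the diagonal matrices `W₁`, `W₂`, `W₃`, hence intertwines `M^α(t)` and `M^{-α}(t)` for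
all `t` at once. It maps solutions to solutions and keeps their Floquet multiplier.

Two analytic facts support this. First, the Green's function is unique off the lattice when `α ∉
Λ*`: the difference of two of them is quasiperiodic and weakly harmonic, and its mollifications have
no Fourier coefficient left, since no frequency it can carry is zero. Second, Fubini is justified by
Schur's test: the kernel is weakly singular, and the boundary, locally a Lipschitz graph, has
surface mass `O(ρ^(d-1))` in balls of radius `ρ`. -/

noncomputable section

namespace SpaceTimeResonators

/-! ### Hill equations with diagonally similar coefficients -/

/-- If `M'` is conjugate to `M` by a constant invertible diagonal matrix, every quasifrequency of
`M` is one of `M'`. -/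
theorem quasifrequencies_subset_of_intertwine {N : ℕ} {T : ℝ}
    {M M' : ℝ → Matrix (Fin N) (Fin N) ℂ} (u : Fin N → ℂ) (hu : ∀ i, u i ≠ 0)
    (h : ∀ t i j, M' t i j * u j = u i * M t i j) :
    quasifrequencies T M ⊆ quasifrequencies T M' := by
  rintro w ⟨ν, hν, φ, hφ, ⟨hd1, hd2, heq⟩, hqp⟩
  have hderiv : ∀ f : ℝ → Fin N → ℂ, Differentiable ℝ f →
      deriv (fun t => u * f t) = fun t => u * deriv f t := by
    intro f hf
    ext1 t
    exact ((hf t).hasDerivAt.const_mul u).deriv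
  refine ⟨ν, hν, fun t => u * φ t, ?_, ⟨?_, ?_, ?_⟩, ?_⟩
  · contrapose! hφ
    ext t i
    have := congrFun (congrFun hφ t) i
    simpa [hu i] using this
  · exact fun t => (hd1 t).const_mul u
  · rw [hderiv φ hd1]
    exact fun t => (hd2 t).const_mul u
  · intro t
    rw [hderiv φ hd1, hderiv _ hd2]
    ext i
    have := congrFun (heq t) i
    simp only [Pi.add_apply, Pi.mul_apply, Pi.zero_apply, Matrix.mulVec, dotProduct] at this ⊢
    have e : ∑ j, M' t i j * (u j * φ t j) = u i * ∑ j, M t i j * φ t j := by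
      rw [Finset.mul_sum]
      refine Finset.sum_congr rfl fun j _ => ?_
      rw [← mul_assoc, h, mul_assoc]
    rw [e, ← mul_add, this, mul_zero]
  · intro t
    simp only [hqp t, mul_smul_comm]

/-- A Hermitian matrix of size at most two is conjugate to its transpose by an invertible diagonal
matrix. -/
theorem exists_diagonal_intertwine_transpose {N : ℕ} (hN : N = 1 ∨ N = 2)
    {C : Matrix (Fin N) (Fin N) ℂ} (hC : C.IsHermitian) :
    ∃ u : Fin N → ℂ, (∀ i, u i ≠ 0) ∧ ∀ i j, C j i * u j = u i * C i j := by
  rcases hN with rfl | rfl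
  · refine ⟨1, by simp, fun i j => ?_⟩
    rw [Subsingleton.elim j i, mul_comm]
  · have h10 : C 1 0 = star (C 0 1) := (hC.apply 1 0).symm
    by_cases h0 : C 0 1 = 0
    · refine ⟨1, by simp, fun i j => ?_⟩
      fin_cases i <;> fin_cases j <;> simp [h10, h0]
    -- With `c = C 0 1`, both off-diagonal conditions are the one equation `star c * u 1 = u 0 * c`.
    · refine ⟨![star (C 0 1), C 0 1], ?_, ?_⟩
      · intro i; fin_cases i <;> simp [h0]
      · intro i j
        fin_cases i <;> fin_cases j <;> simp [h10, mul_comm]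

/-- Diagonal matrices commute, so an intertwiner of `C` and `Cᵀ` passes through `W₁`, `W₂` and `W₃`
and does not depend on `t`. -/
theorem quasifrequencies_hillMatrix_subset {d N : ℕ} (hN : N = 1 ∨ N = 2)
    (R : ResonatorStructure d N) (P : MaterialConstants) (m : TimeModulation N)
    {a b : BrillouinZone R.Λ} (hC : (R.capacitanceMatrix a).IsHermitian)
    (hab : R.capacitanceMatrix b = (R.capacitanceMatrix a).transpose) :
    quasifrequencies m.T (hillMatrix R P m a) ⊆ quasifrequencies m.T (hillMatrix R P m b) := by
  obtain ⟨u, hu, h⟩ := exists_diagonal_intertwine_transpose hN hC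
  refine quasifrequencies_subset_of_intertwine u hu fun t i j => ?_
  have hW : W₃ m t i j * u j = u i * W₃ m t i j := by
    rcases eq_or_ne i j with rfl | hij
    · ring
    · simp [W₃, Matrix.diagonal_apply_ne _ hij]
  have hij := h i j
  simp only [hillMatrix, hab, W₁, W₂, Matrix.add_apply, Matrix.smul_apply, Matrix.mul_diagonal,
    Matrix.diagonal_mul, Matrix.transpose_apply, smul_eq_mul, add_mul, mul_add, hW,
    add_left_inj]
  linear_combination (((P.δ * P.κr / P.ρr : ℝ) : ℂ) *
    ((Real.sqrt (m.κ i t) * m.ρ i t / (volume (R.D i)).toReal : ℝ) : ℂ) *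
    ((Real.sqrt (m.κ j t) / m.ρ j t : ℝ) : ℂ)) * hij

/-! ### Uniqueness of the quasiperiodic Green's function -/

open scoped FourierTransform InnerProductSpace in
theorem fourier_laplacian_of_hasCompactSupport {d : ℕ} {β : EuclideanSpace ℝ (Fin d) → ℂ}
    (hβ : ContDiff ℝ ∞ β) (hβc : HasCompactSupport β) (ξ : EuclideanSpace ℝ (Fin d)) :
    𝓕 (Laplacian.laplacian β) ξ = -((2 * Real.pi) ^ 2 * ‖ξ‖ ^ 2 : ℝ) * 𝓕 β ξ := by
  let f := hβc.toSchwartzMap hβ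
  have hf : (f : EuclideanSpace ℝ (Fin d) → ℂ) = β := rfl
  have h1 : Laplacian.laplacian β = (Laplacian.laplacian f : SchwartzMap _ ℂ) := by
    ext x
    rw [SchwartzMap.laplacian_apply, hf]
  have h2 := SchwartzMap.laplacian_eq_fourierMultiplierCLM f
  rw [SchwartzMap.fourierMultiplierCLM_apply] at h2
  have h3 := congrArg (fun F : SchwartzMap (EuclideanSpace ℝ (Fin d)) ℂ =>
    (𝓕 F : SchwartzMap (EuclideanSpace ℝ (Fin d)) ℂ) ξ) h2
  rw [h1, ← SchwartzMap.fourier_coe, ← hf, ← SchwartzMap.fourier_coe]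
  refine h3.trans ?_
  simp only [FourierTransform.fourier_smul, FourierTransform.fourier_fourierInv_eq,
    smul_apply]
  rw [SchwartzMap.smulLeftCLM_apply_apply (by fun_prop)]
  simp [mul_assoc]

theorem laplacian_comp_const_sub {d : ℕ} {f : EuclideanSpace ℝ (Fin d) → ℂ}
    (hf : ContDiff ℝ ∞ f) (a x : EuclideanSpace ℝ (Fin d)) :
    Laplacian.laplacian (fun y => f (a - y)) x = Laplacian.laplacian f (a - x) := by
  have h1 : ContDiff ℝ 2 (fun y => f (a + y)) := 
    (hf.of_le (by norm_cast)).comp (contDiff_const.add contDiff_id)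
  have h2 : (fun y => f (a - y)) = fun y => (fun z => f (a + z)) ((-1 : ℝ) • y) := by
    ext y; simp [sub_eq_add_neg]
  simp only [InnerProductSpace.laplacian_eq_iteratedFDeriv_stdOrthonormalBasis]
  rw [h2, iteratedFDeriv_comp_const_smul _ h1, iteratedFDeriv_comp_add_left']
  simp [sub_eq_add_neg]

theorem vaddInvariantMeasure_submodule {d : ℕ} (Λ : Submodule ℤ (EuclideanSpace ℝ (Fin d))) :
    VAddInvariantMeasure Λ (EuclideanSpace ℝ (Fin d)) volume :=
  ⟨fun c s _ => measure_preimage_add volume (c : EuclideanSpace ℝ (Fin d)) s⟩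

-- The translate of `Y` by `-t` is again a fundamental domain, and the integral of a periodic
-- function is the same over all of them.
open scoped Pointwise in
theorem setIntegral_sub_right_of_periodic {d : ℕ} {Λ : Submodule ℤ (EuclideanSpace ℝ (Fin d))}
    [Countable Λ] {Y : Set (EuclideanSpace ℝ (Fin d))} (hY : IsAddFundamentalDomain Λ Y volume)
    {H : EuclideanSpace ℝ (Fin d) → ℂ} (hH : ∀ n ∈ Λ, ∀ x, H (x + n) = H x)
    (t : EuclideanSpace ℝ (Fin d)) : ∫ x in Y, H (x - t) = ∫ x in Y, H x := by
  have := vaddInvariantMeasure_submodule Λ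
  have h1 : IsAddFundamentalDomain Λ ((-t) +ᵥ Y) volume := hY.vadd_of_comm (-t)
  have h2 : (-t) +ᵥ Y = (fun x => x - t) '' Y := by
    ext x; simp only [Set.mem_vadd_set, Set.mem_image, vadd_eq_add, sub_eq_neg_add]
  rw [← (measurePreserving_sub_right volume t).setIntegral_image_emb
    (MeasurableEquiv.subRight t).measurableEmbedding H Y, ← h2]
  refine h1.setIntegral_eq hY fun n x => ?_
  rw [Submodule.vadd_def, vadd_eq_add, add_comm, hH n n.2]

/-! ### Fourier uniqueness for lattice-periodic functions -/

/-- The toral coordinates of a point with respect to a lattice basis. -/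
def toTorus {d : ℕ} {ι : Type*} (b : Module.Basis ι ℝ (EuclideanSpace ℝ (Fin d)))
    (x : EuclideanSpace ℝ (Fin d)) : UnitAddTorus ι := fun i => (b.repr x i : UnitAddCircle)

theorem isOpenQuotientMap_toTorus {d : ℕ} {ι : Type*} [Fintype ι]
    (b : Module.Basis ι ℝ (EuclideanSpace ℝ (Fin d))) : IsOpenQuotientMap (toTorus b) := by
  have h1 : IsOpenQuotientMap (Pi.map fun (_ : ι) (x : ℝ) => (x : UnitAddCircle)) :=
    IsOpenQuotientMap.piMap fun _ => QuotientAddGroup.isOpenQuotientMap_mk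
  exact h1.comp b.equivFunL.toHomeomorph.isOpenQuotientMap

theorem eq_add_of_toTorus_eq {d : ℕ} {ι : Type*} [Fintype ι]
    {Λ : Submodule ℤ (EuclideanSpace ℝ (Fin d))}
    (b : Module.Basis ι ℝ (EuclideanSpace ℝ (Fin d))) (hb : Submodule.span ℤ (Set.range b) = Λ)
    {x y : EuclideanSpace ℝ (Fin d)} (h : toTorus b x = toTorus b y) : x - y ∈ Λ := by
  have h' : ∀ i, ∃ k : ℤ, b.repr x i - b.repr y i = k := by
    intro i
    have := congrFun h i
    simp only [toTorus] at this
    rw [eq_comm, QuotientAddGroup.eq, AddSubgroup.mem_zmultiples_iff] at this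
    obtain ⟨k, hk⟩ := this
    exact ⟨k, by simp at hk; linarith⟩
  choose k hk using h'
  rw [← hb, ← b.sum_repr (x - y)]
  refine Submodule.sum_mem _ fun i _ => ?_
  have : b.repr (x - y) i • b i = k i • b i := by
    rw [map_sub, Finsupp.sub_apply, hk, Int.cast_smul_eq_zsmul]
  rw [this]
  exact Submodule.smul_mem _ _ (Submodule.subset_span ⟨i, rfl⟩)

open scoped Pointwise in
/-- A continuous periodic function all of whose Fourier coefficients vanish is zero. -/
theorem eq_zero_of_fourier_coefficients_eq_zero {d : ℕ} {ι : Type*} [Fintype ι]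
    {Λ : Submodule ℤ (EuclideanSpace ℝ (Fin d))} [Countable Λ]
    {Y : Set (EuclideanSpace ℝ (Fin d))} (hYb : Bornology.IsBounded Y)
    (hY : IsAddFundamentalDomain Λ Y volume)
    (b : Module.Basis ι ℝ (EuclideanSpace ℝ (Fin d))) (hb : Submodule.span ℤ (Set.range b) = Λ)
    {F : EuclideanSpace ℝ (Fin d) → ℂ} (hF : Continuous F) (hper : ∀ n ∈ Λ, ∀ x, F (x + n) = F x)
    (hcoef : ∀ m : ι → ℤ, ∫ x in Y, F x * UnitAddTorus.mFourier m (toTorus b x) = 0) :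
    F = 0 := by
  have hq := isOpenQuotientMap_toTorus b
  have hFi : ∀ K : EuclideanSpace ℝ (Fin d) → ℂ, Continuous K → IntegrableOn K Y volume :=
    fun K hK => (hK.continuousOn.integrableOn_compact hYb.isCompact_closure).mono_set subset_closure
  have hint : ∀ G : C(UnitAddTorus ι, ℂ), IntegrableOn (fun x => F x * G (toTorus b x)) Y volume :=
    fun G => hFi _ (hF.mul (G.continuous.comp hq.continuous))
  -- Pairing with `F` is a bounded functional on continuous functions on the torus. It kills the
  -- trigonometric monomials, whose span is dense, so it is zero.
  let L : C(UnitAddTorus ι, ℂ) →ₗ[ℂ] ℂ :=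
    { toFun := fun G => ∫ x in Y, F x * G (toTorus b x)
      map_add' := fun G G' => by
        simp only [ContinuousMap.add_apply, mul_add]
        exact integral_add (hint G) (hint G')
      map_smul' := fun c G => by
        simp only [ContinuousMap.smul_apply, smul_eq_mul, RingHom.id_apply, ← integral_const_mul]
        congr 1; ext x; ring }
  let L' : C(UnitAddTorus ι, ℂ) →L[ℂ] ℂ := L.mkContinuous (∫ x in Y, ‖F x‖) fun G => by
    rw [← integral_mul_const]
    refine norm_integral_le_of_norm_le ((hFi F hF).norm.mul_const _) (ae_of_all _ fun x => ?_)
    rw [norm_mul]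
    gcongr
    exact G.norm_coe_le_norm _
  have hL : ∀ G, L' G = 0 := by
    have h1 : (Submodule.span ℂ (Set.range (UnitAddTorus.mFourier (d := ι)))).topologicalClosure ≤
        LinearMap.ker L'.toLinearMap := by
      refine Submodule.topologicalClosure_minimal _ ?_ L'.isClosed_ker
      rw [Submodule.span_le]
      rintro _ ⟨m, rfl⟩
      exact hcoef m
    rw [UnitAddTorus.span_mFourier_closure_eq_top] at h1
    exact fun G => h1 (Submodule.mem_top (x := G))
  have hfac : Function.FactorsThrough (fun x => star (F x)) (toTorus b) := fun x y hxy => by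
    have := hper _ (eq_add_of_toTorus_eq b hb hxy) y
    simp only [add_sub_cancel] at this
    simp [this]
  let π : C(EuclideanSpace ℝ (Fin d), UnitAddTorus ι) := ⟨toTorus b, hq.continuous⟩
  have hπ : Topology.IsQuotientMap π := hq.isQuotientMap
  -- The conjugate of `F` descends to the torus; testing against it yields `∫ ‖F‖² = 0` over `Y`.
  let G : C(UnitAddTorus ι, ℂ) := hπ.lift ⟨fun x => star (F x), by fun_prop⟩ hfac
  have hG : ∀ x, G (toTorus b x) = star (F x) := fun x =>
    congrArg (fun k : C(EuclideanSpace ℝ (Fin d), ℂ) => k x)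
      (hπ.lift_comp ⟨fun x => star (F x), by fun_prop⟩ hfac)
  have h0 : ∫ x in Y, ‖F x‖ ^ 2 = 0 := by
    have h1 : ∫ x in Y, F x * G (toTorus b x) = 0 := hL G
    have h2 : ∀ x, F x * G (toTorus b x) = ((‖F x‖ ^ 2 : ℝ) : ℂ) := fun x => by
      rw [hG, Complex.star_def, Complex.mul_conj, Complex.normSq_eq_norm_sq]
    simp only [h2] at h1
    have h3 := integral_ofReal (𝕜 := ℂ) (f := fun x => ‖F x‖ ^ 2) (μ := volume.restrict Y)
    exact Complex.ofReal_eq_zero.1 (h3.symm.trans h1)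
  have h3 : ∀ᵐ x ∂volume.restrict Y, F x = 0 := by
    have hc : Continuous fun x => ‖F x‖ ^ 2 := by fun_prop
    have hi : IntegrableOn (fun x => ‖F x‖ ^ 2) Y volume :=
      (hc.continuousOn.integrableOn_compact hYb.isCompact_closure).mono_set subset_closure
    filter_upwards [(integral_eq_zero_iff_of_nonneg (fun x => by positivity) hi).1 h0] with x hx
    simpa using hx
  have := vaddInvariantMeasure_submodule Λ
  have h4 : volume {x | F x ≠ 0} = 0 := by
    refine hY.measure_zero_of_invariant _ (fun n => ?_) ?_
    · ext x
      rw [Set.mem_vadd_set_iff_neg_vadd_mem]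
      simp only [Set.mem_ofPred_eq, Submodule.vadd_def, vadd_eq_add]
      rw [add_comm, hper _ (-n).2]
    · have hm : MeasurableSet {x | F x ≠ 0} := (isOpen_ne_fun hF continuous_const).measurableSet
      rw [← Measure.restrict_apply hm]
      exact h3
  exact (Continuous.ae_eq_iff_eq volume hF continuous_const).1 h4

/-! ### Convolution and quasiperiodic harmonic functions -/

theorem _root_.HasCompactSupport.laplacian {d : ℕ} {β : EuclideanSpace ℝ (Fin d) → ℂ}
    (hβc : HasCompactSupport β) : HasCompactSupport (Laplacian.laplacian β) := by
  refine HasCompactSupport.intro hβc.isCompact fun x hx => ?_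
  have h1 : β =ᶠ[nhds x] fun _ => 0 := notMem_tsupport_iff_eventuallyEq.1 hx
  rw [(InnerProductSpace.laplacian_congr_nhds h1).eq_of_nhds]
  simp

theorem _root_.ContDiff.laplacian_of_hasCompactSupport {d : ℕ}
    {β : EuclideanSpace ℝ (Fin d) → ℂ} (hβ : ContDiff ℝ ∞ β) (hβc : HasCompactSupport β) :
    ContDiff ℝ ∞ (Laplacian.laplacian β) := by
  have h1 : Laplacian.laplacian β =
      (Laplacian.laplacian (hβc.toSchwartzMap hβ) : SchwartzMap (EuclideanSpace ℝ (Fin d)) ℂ) := by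
    ext x
    rw [SchwartzMap.laplacian_apply]
    rfl
  rw [h1]
  exact SchwartzMap.smooth _ ⊤

/-- For `x ∈ Y` and `t` in the support of `β`, the point `x - t` stays in a fixed ball, so `h` may
be truncated to an integrable function. -/
theorem integrable_prod_mul_sub {d : ℕ} {Y : Set (EuclideanSpace ℝ (Fin d))}
    (hYb : Bornology.IsBounded Y) {h β : EuclideanSpace ℝ (Fin d) → ℂ}
    (hh : LocallyIntegrable h volume) (hβ : Continuous β) (hβc : HasCompactSupport β) :
    Integrable (fun p : EuclideanSpace ℝ (Fin d) × EuclideanSpace ℝ (Fin d) =>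
      β p.2 * h (p.1 - p.2)) ((volume.restrict Y).prod volume) := by
  obtain ⟨r, hr⟩ := hYb.subset_closedBall 0
  obtain ⟨s, hs⟩ := hβc.isCompact.isBounded.subset_closedBall 0
  let S : Set (EuclideanSpace ℝ (Fin d)) := Metric.closedBall 0 (r + s)
  have hS : Integrable (S.indicator h) volume :=
    (integrable_indicator_iff measurableSet_closedBall).2
      (hh.integrableOn_isCompact (isCompact_closedBall _ _))
  have h1 := (hβ.integrable_of_hasCompactSupport hβc).convolution_integrand
    (ContinuousLinearMap.mul ℝ ℂ) hS (μ := volume) (ν := volume)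
  have h2 : IntegrableOn (fun p : EuclideanSpace ℝ (Fin d) × EuclideanSpace ℝ (Fin d) =>
      β p.2 * h (p.1 - p.2)) (Metric.closedBall 0 r ×ˢ Set.univ) (volume.prod volume) := by
    refine h1.integrableOn.congr_fun ?_ (measurableSet_closedBall.prod .univ)
    rintro ⟨x, t⟩ ⟨hx, -⟩
    simp only [ContinuousLinearMap.mul_apply']
    by_cases ht : t ∈ tsupport β
    · have : x - t ∈ S := by
        have ht' := hs ht
        simp only [S, mem_closedBall_zero_iff] at hx ht' ⊢
        exact (norm_sub_le _ _).trans (add_le_add hx ht')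
      rw [Set.indicator_of_mem this]
    · rw [image_eq_zero_of_notMem_tsupport ht]; simp
  have h3 := h2.mono_set (Set.prod_mono hr (subset_refl Set.univ))
  rwa [IntegrableOn, ← Measure.prod_restrict, Measure.restrict_univ] at h3

/-- Convolution theorem on a unit cell: after Fubini the character splits as `e t * e (x - t)`, and
translation invariance of the cell integral of the periodic function `h * e` removes `t`. -/
theorem setIntegral_convolution_mul_char {d : ℕ} {Λ : Submodule ℤ (EuclideanSpace ℝ (Fin d))}
    [Countable Λ] {Y : Set (EuclideanSpace ℝ (Fin d))} (hYb : Bornology.IsBounded Y)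
    (hY : IsAddFundamentalDomain Λ Y volume) {h β e : EuclideanSpace ℝ (Fin d) → ℂ}
    (hh : LocallyIntegrable h volume) (hβ : Continuous β) (hβc : HasCompactSupport β)
    (he : Continuous e) (he1 : ∀ x, ‖e x‖ = 1) (hadd : ∀ x t, e x = e t * e (x - t))
    (hper : ∀ n ∈ Λ, ∀ x, h (x + n) * e (x + n) = h x * e x) :
    ∫ x in Y, (∫ t, β t * h (x - t)) * e x = (∫ x in Y, h x * e x) * ∫ t, e t * β t := by
  have hint : Integrable (fun p : EuclideanSpace ℝ (Fin d) × EuclideanSpace ℝ (Fin d) =>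
      β p.2 * h (p.1 - p.2) * e p.1) ((volume.restrict Y).prod volume) :=
    (integrable_prod_mul_sub hYb hh hβ hβc).mul_bdd (c := 1) (by fun_prop)
      (ae_of_all _ fun p => (he1 _).le)
  trans ∫ x in Y, ∫ t, β t * h (x - t) * e x
  · simp only [integral_mul_const]
  rw [integral_integral_swap hint, ← integral_const_mul]
  congr 1
  ext t
  have h1 : ∀ x, β t * h (x - t) * e x = e t * β t * (h (x - t) * e (x - t)) := fun x => by
    rw [hadd x t]; ring
  simp only [h1]
  rw [integral_const_mul, setIntegral_sub_right_of_periodic hY (H := fun x => h x * e x) hper]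
  ring

open scoped FourierTransform in
/-- For `α ∉ Λ*`, there is no nonzero `α`-quasiperiodic harmonic function. -/
theorem ae_eq_zero_of_quasiperiodic_of_harmonic {d : ℕ}
    {Λ : Submodule ℤ (EuclideanSpace ℝ (Fin d))} [DiscreteTopology Λ] [IsZLattice ℝ Λ]
    {Y : Set (EuclideanSpace ℝ (Fin d))} (hYb : Bornology.IsBounded Y)
    (hY : IsAddFundamentalDomain Λ Y volume) {α : EuclideanSpace ℝ (Fin d)}
    (hα : α ∉ dualLattice Λ) {h : EuclideanSpace ℝ (Fin d) → ℂ}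
    (hh : LocallyIntegrable h volume)
    (hq : ∀ n ∈ Λ, ∀ x, h (x + n) = Complex.exp (Complex.I * ((inner ℝ α n : ℝ) : ℂ)) * h x)
    (hw : ∀ φ : EuclideanSpace ℝ (Fin d) → ℂ, ContDiff ℝ ∞ φ → HasCompactSupport φ →
      ∫ x, h x * Laplacian.laplacian φ x = 0) :
    ∀ᵐ x, h x = 0 := by
  let b₀ := Module.Free.chooseBasis ℤ Λ
  let b := b₀.ofZLatticeBasis ℝ Λ
  have hb : Submodule.span ℤ (Set.range b) = Λ := b₀.ofZLatticeBasis_span ℝ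
  have key : ∀ β : EuclideanSpace ℝ (Fin d) → ℂ, ContDiff ℝ ∞ β → HasCompactSupport β →
      ∫ t, β t * h (0 - t) = 0 := by
    intro β hβ hβc
    -- Convolution makes `h` continuous, and the exponential cancels its quasiperiodicity: `F` is
    -- continuous and `Λ`-periodic.
    let F : EuclideanSpace ℝ (Fin d) → ℂ := fun x =>
      (∫ t, β t * h (x - t)) * Complex.exp (-Complex.I * ((inner ℝ α x : ℝ) : ℂ))
    have hF : F = 0 := by
      refine eq_zero_of_fourier_coefficients_eq_zero hYb hY b hb ?_ ?_ fun m => ?_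
      · refine Continuous.mul ?_ (by fun_prop)
        exact hβc.continuous_convolution_left (ContinuousLinearMap.mul ℝ ℂ) hβ.continuous hh
      · intro n hn x
        have h1 : ∀ t, β t * h (x + n - t) =
            Complex.exp (Complex.I * ((inner ℝ α n : ℝ) : ℂ)) * (β t * h (x - t)) := fun t => by
          rw [show x + n - t = x - t + n by abel, hq n hn]; ring
        simp only [F, h1, integral_const_mul, inner_add_right]
        rw [mul_right_comm, ← Complex.exp_add, mul_comm]
        congr 2
        push_cast; ring
      · let l : EuclideanSpace ℝ (Fin d) →L[ℝ] ℝ :=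
          LinearMap.toContinuousLinearMap (∑ i, (m i : ℝ) • b.coord i)
        let v := (InnerProductSpace.toDual ℝ _).symm l
        have hv : ∀ x, inner ℝ v x = ∑ i, m i * b.repr x i := fun x => by
          rw [InnerProductSpace.toDual_symm_apply]; simp [l]
        have hchar : ∀ x, UnitAddTorus.mFourier m (toTorus b x) =
            Complex.exp (2 * Real.pi * Complex.I * (inner ℝ v x : ℝ)) := by
          intro x
          simp only [UnitAddTorus.mFourier, ContinuousMap.coe_mk, toTorus, fourier_coe_apply]
          rw [← Complex.exp_sum, hv]
          push_cast
          rw [Finset.mul_sum]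
          congr 1
          refine Finset.sum_congr rfl fun i _ => by ring
        -- The monomial `m` is `e^{2πi v·x}`. This `ξ` makes `e^{-iα·x}` times the monomial equal to
        -- `e^{-2πi x·ξ}`, the kernel of the Fourier transform at `ξ`.
        let ξ : EuclideanSpace ℝ (Fin d) := (2 * Real.pi)⁻¹ • α - v
        let e : EuclideanSpace ℝ (Fin d) → ℂ := fun x => Real.fourierChar (-inner ℝ x ξ)
        have he : ∀ x, e x = Complex.exp (-Complex.I * ((inner ℝ α x : ℝ) : ℂ)) *
            UnitAddTorus.mFourier m (toTorus b x) := by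
          intro x
          rw [hchar, ← Complex.exp_add]
          simp only [e, Real.fourierChar_apply, ξ, real_inner_comm _ x, inner_sub_left,
            inner_smul_left]
          congr 1
          have : (Real.pi : ℂ) ≠ 0 := by exact_mod_cast Real.pi_ne_zero
          push_cast
          simp
          field_simp
          ring
        have hintZ : ∀ n ∈ Λ, ∃ k : ℤ, inner ℝ v n = k := by
          intro n hn
          refine ⟨∑ i, m i * b₀.repr ⟨n, hn⟩ i, ?_⟩
          rw [hv]
          push_cast
          refine Finset.sum_congr rfl fun i _ => ?_
          rw [← b₀.ofZLatticeBasis_repr_apply ℝ Λ ⟨n, hn⟩ i]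
        -- Since `v` is integral on `Λ`, `ξ = 0` would put `α = 2πv` in `Λ*`.
        have hξ : ξ ≠ 0 := by
          intro h0
          refine hα fun n hn => ?_
          obtain ⟨k, hk⟩ := hintZ n hn
          refine ⟨k, ?_⟩
          have : α = (2 * Real.pi) • v := by
            rw [← sub_eq_zero.1 h0, smul_smul, mul_inv_cancel₀ (by positivity), one_smul]
          rw [this, inner_smul_left, hk]; simp
        have hadd : ∀ x t, e x = e t * e (x - t) := by
          intro x t
          simp only [e]
          rw [← Circle.coe_mul, ← AddChar.map_add_eq_mul, ← neg_add, ← inner_add_left,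
            add_sub_cancel]
        have hper : ∀ n ∈ Λ, ∀ x, h (x + n) * e (x + n) = h x * e x := by
          intro n hn x
          have e1 : e n = Complex.exp (-Complex.I * ((inner ℝ α n : ℝ) : ℂ)) := by
            obtain ⟨k, hk⟩ := hintZ n hn
            rw [he, hchar, hk]
            have : Complex.exp (2 * Real.pi * Complex.I * ((k : ℝ) : ℂ)) = 1 := by
              rw [Complex.exp_eq_one_iff]
              exact ⟨k, by push_cast; ring⟩
            rw [this, mul_one]
          have e2 : e (x + n) = e n * e x := by
            rw [hadd (x + n) n, add_sub_cancel_right]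
          rw [e2, e1, hq n hn]
          have : Complex.exp (Complex.I * ((inner ℝ α n : ℝ) : ℂ)) *
              Complex.exp (-Complex.I * ((inner ℝ α n : ℝ) : ℂ)) = 1 := by
            rw [← Complex.exp_add]; simp
          linear_combination (h x * e x) * this
        have hec : Continuous e := by
          have := Real.continuous_fourierChar
          fun_prop
        have he1 : ∀ x, ‖e x‖ = 1 := fun x => Circle.norm_coe _
        have hβl : ContDiff ℝ ∞ (Laplacian.laplacian β) := hβ.laplacian_of_hasCompactSupport hβc
        have hβlc : HasCompactSupport (Laplacian.laplacian β) := hβc.laplacian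
        -- With `A = ∫_Y h e`, `c1` expresses the coefficient as `A * 𝓕 β ξ`. By harmonicity `c2`
        -- becomes `0 = A * 𝓕 (Δβ) ξ = -(2π‖ξ‖)² * A * 𝓕 β ξ`, so the coefficient vanishes.
        have c1 := setIntegral_convolution_mul_char hYb hY hh hβ.continuous hβc hec he1 hadd hper
        have c2 := setIntegral_convolution_mul_char hYb hY hh hβl.continuous hβlc hec he1 hadd hper
        have hzero : ∀ x, ∫ t, Laplacian.laplacian β t * h (x - t) = 0 := by
          intro x
          have := hw (fun y => β (x - y)) (hβ.comp (contDiff_const.sub contDiff_id))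
            (hβc.comp_homeomorph (Homeomorph.subLeft x))
          rw [← this, ← integral_sub_left_eq_self _ volume x]
          congr 1
          ext y
          rw [laplacian_comp_const_sub hβ, mul_comm]
          simp
        simp only [hzero, zero_mul, integral_zero] at c2
        have f1 : ∀ γ : EuclideanSpace ℝ (Fin d) → ℂ, ∫ t, e t * γ t = 𝓕 γ ξ := by
          intro γ
          rw [Real.fourier_eq]
          rfl
        rw [f1, fourier_laplacian_of_hasCompactSupport hβ hβc] at c2
        rw [f1] at c1
        have hpos : ((-((2 * Real.pi) ^ 2 * ‖ξ‖ ^ 2 : ℝ)) : ℂ) ≠ 0 := by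
          have : (2 * Real.pi) ^ 2 * ‖ξ‖ ^ 2 ≠ 0 := by
            have := norm_ne_zero_iff.2 hξ
            positivity
          exact neg_ne_zero.2 (by exact_mod_cast this)
        have : ∫ x in Y, (∫ t, β t * h (x - t)) * e x = 0 := by
          rw [c1]
          refine (mul_eq_zero.1 ?_).resolve_left hpos
          rw [c2]; ring
        rw [← this]
        congr 1
        ext x
        rw [he]
        simp only [F]
        ring
    simpa [F] using congrFun hF 0
  refine ae_eq_zero_of_integral_contDiff_smul_eq_zero hh fun g hg hgc => ?_
  have h1 := key (fun t => (g (-t) : ℂ)) (Complex.ofRealCLM.contDiff.comp (hg.comp contDiff_neg))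
    ((hgc.comp_homeomorph (Homeomorph.neg _)).comp_left Complex.ofReal_zero)
  rw [← h1, ← integral_neg_eq_self]
  simp

theorem exp_inner_eq_of_sub_mem_dualLattice {d : ℕ} {Λ : Submodule ℤ (EuclideanSpace ℝ (Fin d))}
    {α α' : EuclideanSpace ℝ (Fin d)} (h : α - α' ∈ dualLattice Λ)
    {n : EuclideanSpace ℝ (Fin d)} (hn : n ∈ Λ) :
    Complex.exp (Complex.I * ((inner ℝ α n : ℝ) : ℂ)) =
      Complex.exp (Complex.I * ((inner ℝ α' n : ℝ) : ℂ)) := by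
  obtain ⟨k, hk⟩ := h n hn
  rw [Complex.exp_eq_exp_iff_exists_int]
  refine ⟨k, ?_⟩
  rw [inner_sub_left] at hk
  rw [sub_eq_iff_eq_add.1 hk]
  push_cast; ring

theorem isClosed_lattice {d : ℕ} (Λ : Submodule ℤ (EuclideanSpace ℝ (Fin d)))
    [DiscreteTopology Λ] : IsClosed (Λ : Set (EuclideanSpace ℝ (Fin d))) :=
  have : DiscreteTopology Λ.toAddSubgroup := inferInstanceAs (DiscreteTopology Λ)
  AddSubgroup.isClosed_of_discrete (H := Λ.toAddSubgroup)

/-! ### Uniqueness and symmetries of the Green's function -/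

namespace IsQuasiperiodicGreen

variable {d : ℕ} {Λ : Submodule ℤ (EuclideanSpace ℝ (Fin d))}
  {α α' : EuclideanSpace ℝ (Fin d)} {g g' : EuclideanSpace ℝ (Fin d) → ℂ}

theorem integrable_mul_laplacian (hg : IsQuasiperiodicGreen Λ α g)
    {φ : EuclideanSpace ℝ (Fin d) → ℂ} (hφ : ContDiff ℝ ∞ φ) (hφc : HasCompactSupport φ) :
    Integrable (fun x => g x * Laplacian.laplacian φ x) volume := by
  have := hg.locallyIntegrable.integrable_smul_right_of_hasCompactSupport
    (hφ.laplacian_of_hasCompactSupport hφc).continuous hφc.laplacian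
  exact this

/-- For `α ∉ Λ*` the quasiperiodic Green's function is unique off the lattice. -/
theorem eq_of_notMem [DiscreteTopology Λ] [IsZLattice ℝ Λ]
    {Y : Set (EuclideanSpace ℝ (Fin d))} (hYb : Bornology.IsBounded Y)
    (hY : IsAddFundamentalDomain Λ Y volume) (hα : α ∉ dualLattice Λ)
    (hαα' : α - α' ∈ dualLattice Λ) (hg : IsQuasiperiodicGreen Λ α g)
    (hg' : IsQuasiperiodicGreen Λ α' g') {x : EuclideanSpace ℝ (Fin d)} (hx : x ∉ Λ) :
    g x = g' x := by
  have h0 : ∀ᵐ x, g x - g' x = 0 := by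
    refine ae_eq_zero_of_quasiperiodic_of_harmonic hYb hY hα
      (hg.locallyIntegrable.sub hg'.locallyIntegrable) (fun n hn x => ?_) fun φ hφ hφc => ?_
    · rw [hg.quasiperiodic n hn, hg'.quasiperiodic n hn,
        exp_inner_eq_of_sub_mem_dualLattice hαα' hn, mul_sub]
    · simp only [sub_mul]
      rw [integral_sub (hg.integrable_mul_laplacian hφ hφc) (hg'.integrable_mul_laplacian hφ hφc),
        hg.equation φ hφ hφc, hg'.equation φ hφ hφc, sub_eq_zero]
      exact tsum_congr fun n => by rw [exp_inner_eq_of_sub_mem_dualLattice hαα' n.2]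
  -- Continuity on this open set upgrades the almost everywhere equality to equality at every point.
  have hU : IsOpen {x | x ∉ Λ} := (isClosed_lattice Λ).isOpen_compl
  refine Measure.eqOn_open_of_ae_eq (μ := volume) (U := {x | x ∉ Λ}) ?_ hU hg.continuousOn
    hg'.continuousOn hx
  exact ae_restrict_of_ae (h0.mono fun x hx => sub_eq_zero.1 hx)

/-- Reflection preserves `Λ` and commutes with the Laplacian; reindexing the sources by `n ↦ -n`
replaces `α` by `-α`. -/
theorem comp_neg (hg : IsQuasiperiodicGreen Λ α g) :
    IsQuasiperiodicGreen Λ (-α) fun x => g (-x) where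
  quasiperiodic n hn x := by
    rw [neg_add, hg.quasiperiodic (-n) (Λ.neg_mem hn), inner_neg_left, inner_neg_right]
  continuousOn := hg.continuousOn.comp continuousOn_neg fun x hx => by simpa using hx
  locallyIntegrable := by
    intro x
    obtain ⟨u, hu, h⟩ := hg.locallyIntegrable (-x)
    exact ⟨Neg.neg ⁻¹' u, continuous_neg.continuousAt.preimage_mem_nhds hu,
      ((Measure.measurePreserving_neg volume).integrableOn_comp_preimage
        (MeasurableEquiv.neg _).measurableEmbedding).2 h⟩
  equation φ hφ hφc := by
    have h1 := hg.equation (fun x => φ (0 - x)) (hφ.comp (contDiff_const.sub contDiff_id))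
      (hφc.comp_homeomorph (Homeomorph.subLeft 0))
    simp only [laplacian_comp_const_sub hφ] at h1
    rw [← integral_neg_eq_self] at h1
    simp only [zero_sub, neg_neg] at h1
    rw [h1, ← (Equiv.neg Λ).tsum_eq]
    simp
  singularity := by
    obtain ⟨K, r, hr, h⟩ := hg.singularity
    refine ⟨K, r, hr, fun x hx hxr => ?_⟩
    have := h (-x) (by simpa using hx) (by simpa using hxr)
    simpa [laplaceFundamentalSolution] using this

/-- The Laplacian and the singularity are real, so conjugation only reverses the phases. -/
theorem conj (hg : IsQuasiperiodicGreen Λ α g) :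
    IsQuasiperiodicGreen Λ (-α) fun x => starRingEnd ℂ (g x) where
  quasiperiodic n hn x := by
    rw [hg.quasiperiodic n hn, map_mul, ← Complex.exp_conj]
    simp
  continuousOn := Complex.continuous_conj.comp_continuousOn hg.continuousOn
  locallyIntegrable := by
    intro x
    obtain ⟨u, hu, h⟩ := hg.locallyIntegrable x
    exact ⟨u, hu, (Complex.conjLIE.integrable_comp_iff).2 h⟩
  equation φ hφ hφc := by
    have hφ' : ContDiff ℝ ∞ fun x => starRingEnd ℂ (φ x) := Complex.conjCLE.contDiff.comp hφ
    have h1 := hg.equation (fun x => starRingEnd ℂ (φ x)) hφ' (hφc.comp_left (map_zero _))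
    have h2 : ∀ x, Laplacian.laplacian (fun x => starRingEnd ℂ (φ x)) x =
        starRingEnd ℂ (Laplacian.laplacian φ x) := fun x =>
      ContDiffAt.laplacian_CLM_comp_left (l := Complex.conjCLE.toContinuousLinearMap)
        (hφ.contDiffAt.of_le (by norm_cast))
    have h3 := congrArg (starRingEnd ℂ) h1
    rw [← integral_conj, Complex.conj_tsum] at h3
    simp only [h2, map_mul, Complex.conj_conj, ← Complex.exp_conj] at h3
    rw [h3]
    simp
  singularity := by
    obtain ⟨K, r, hr, h⟩ := hg.singularity
    refine ⟨K, r, hr, fun x hx hxr => ?_⟩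
    rw [← Complex.norm_conj]
    simpa using h x hx hxr

end IsQuasiperiodicGreen

/-! ### Surface measure of the resonator boundaries -/

open ResonatorStructure (surfaceMeasure)

/-- Upper Ahlfors regularity of dimension `k` of the set `S` for the measure `μ`. -/
def UpperRegular {d : ℕ} (μ : Measure (EuclideanSpace ℝ (Fin d))) (k : ℕ)
    (S : Set (EuclideanSpace ℝ (Fin d))) : Prop :=
  ∃ C : ℝ≥0, ∀ x, ∀ ρ : ℝ, 0 ≤ ρ → μ (S ∩ Metric.ball x ρ) ≤ C * ENNReal.ofReal (ρ ^ k)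

theorem UpperRegular.mono {d k : ℕ} {μ : Measure (EuclideanSpace ℝ (Fin d))}
    {S S' : Set (EuclideanSpace ℝ (Fin d))} (h : S ⊆ S') (hS' : UpperRegular μ k S') :
    UpperRegular μ k S := by
  obtain ⟨C, hC⟩ := hS'
  exact ⟨C, fun x ρ hρ => (measure_mono (Set.inter_subset_inter_left _ h)).trans (hC x ρ hρ)⟩

theorem UpperRegular.empty {d k : ℕ} {μ : Measure (EuclideanSpace ℝ (Fin d))} :
    UpperRegular μ k ∅ := ⟨0, by simp⟩

theorem UpperRegular.union {d k : ℕ} {μ : Measure (EuclideanSpace ℝ (Fin d))}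
    {S S' : Set (EuclideanSpace ℝ (Fin d))} (hS : UpperRegular μ k S) (hS' : UpperRegular μ k S') :
    UpperRegular μ k (S ∪ S') := by
  obtain ⟨C, hC⟩ := hS
  obtain ⟨C', hC'⟩ := hS'
  refine ⟨C + C', fun x ρ hρ => ?_⟩
  rw [Set.union_inter_distrib_right, ENNReal.coe_add, add_mul]
  exact (measure_union_le _ _).trans (add_le_add (hC x ρ hρ) (hC' x ρ hρ))

theorem UpperRegular.iUnion {d k N : ℕ} {μ : Measure (EuclideanSpace ℝ (Fin d))}
    {S : Fin N → Set (EuclideanSpace ℝ (Fin d))} (hS : ∀ i, UpperRegular μ k (S i)) :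
    UpperRegular μ k (⋃ i, S i) := by
  choose C hC using hS
  refine ⟨∑ i, C i, fun x ρ hρ => ?_⟩
  rw [Set.iUnion_inter, ENNReal.ofNNReal_finsetSum, Finset.sum_mul]
  exact (measure_iUnion_fintype_le _ _).trans (Finset.sum_le_sum fun i _ => hC i x ρ hρ)

theorem mem_graph_of_mem_frontier {d : ℕ} {U : Set (EuclideanSpace ℝ (Fin d))}
    {ν p : EuclideanSpace ℝ (Fin d)} {γ : (Submodule.span ℝ {ν})ᗮ → ℝ} (hγ : Continuous γ) {r : ℝ}
    (h : ∀ x ∈ Metric.ball p r,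
      x ∈ U ↔ inner ℝ ν x < γ ((Submodule.span ℝ {ν})ᗮ.orthogonalProjectionOnto x))
    {y : EuclideanSpace ℝ (Fin d)} (hy : y ∈ frontier U) (hyr : y ∈ Metric.ball p r) :
    inner ℝ ν y = γ ((Submodule.span ℝ {ν})ᗮ.orthogonalProjectionOnto y) := by
  have hc1 : Continuous fun x : EuclideanSpace ℝ (Fin d) => inner ℝ ν x := by fun_prop
  have hc2 : Continuous fun x : EuclideanSpace ℝ (Fin d) =>
      γ ((Submodule.span ℝ {ν})ᗮ.orthogonalProjectionOnto x) := by fun_prop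
  have hb := Metric.isOpen_ball.mem_nhds hyr
  refine le_antisymm (le_of_not_gt fun hlt => ?_) (le_of_not_gt fun hlt => ?_)
  · have h1 : Uᶜ ∈ nhds y := by
      filter_upwards [hb, (isOpen_lt hc2 hc1).mem_nhds hlt] with x hx hx' hxU
      exact lt_asymm ((h x hx).1 hxU) hx'
    rw [← mem_interior_iff_mem_nhds, interior_compl] at h1
    exact h1 hy.1
  · have h1 : U ∈ nhds y := by
      filter_upwards [hb, (isOpen_lt hc1 hc2).mem_nhds hlt] with x hx hx'
      exact (h x hx).2 hx'
    exact hy.2 (mem_interior_iff_mem_nhds.2 h1)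

theorem euclideanHausdorffMeasure_image_le {X Z : Type*} [MetricSpace X] [MeasurableSpace X]
    [BorelSpace X] [MetricSpace Z] [MeasurableSpace Z] [BorelSpace Z] {f : X → Z} {L : ℝ≥0}
    {A : Set X} (hf : LipschitzOnWith L f A) (k : ℕ) :
    (Measure.euclideanHausdorffMeasure k : Measure Z) (f '' A) ≤
      (L : ENNReal) ^ k * (Measure.euclideanHausdorffMeasure k : Measure X) A := by
  simp only [Measure.euclideanHausdorffMeasure_def, Measure.smul_apply, ENNReal.smul_def,
    smul_eq_mul]
  have := hf.hausdorffMeasure_image_le (d := (k : ℝ)) (by positivity)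
  rw [ENNReal.rpow_natCast] at this
  calc _ ≤ _ := mul_le_mul_right this _
    _ = _ := by ring

/-- Near `p` the boundary lies on the image of the Lipschitz map `v ↦ v + γ v • ν`. The projection
is a contraction, so the part in a ball of radius `ρ` comes from a ball of radius `ρ` in a space of
dimension `d - 1`. -/
theorem HasC1HolderBoundary.exists_nhds_upperRegular {d : ℕ} {s : ℝ≥0}
    {U : Set (EuclideanSpace ℝ (Fin d))} (hU : HasC1HolderBoundary s U)
    {p : EuclideanSpace ℝ (Fin d)} (hp : p ∈ frontier U) :
    ∃ r > 0, UpperRegular (surfaceMeasure d) (d - 1) (frontier U ∩ Metric.ball p r) := by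
  obtain ⟨ν, hν, γ, hγ, -, r, hr, h⟩ := hU p hp
  let V := (Submodule.span ℝ {ν})ᗮ
  let P : EuclideanSpace ℝ (Fin d) →L[ℝ] V := V.orthogonalProjectionOnto
  have hdim : Module.finrank ℝ V = d - 1 := by
    have h1 := Submodule.finrank_add_finrank_orthogonal (Submodule.span ℝ {ν})
    have hν0 : ν ≠ 0 := fun h0 => by simp [h0] at hν
    rw [finrank_span_singleton hν0, finrank_euclideanSpace_fin] at h1
    exact Nat.eq_sub_of_add_eq' h1
  have hPn : ∀ x y, dist (P x) (P y) ≤ dist x y := fun x y => by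
    simpa using V.lipschitzWith_orthogonalProjectionOnto.dist_le_mul x y
  obtain ⟨K, t, ht, hK⟩ := (hγ.contDiffAt (x := P p)).exists_lipschitzOnWith
  obtain ⟨r', hr', hrt⟩ := Metric.mem_nhds_iff.1 ht
  let G : V → EuclideanSpace ℝ (Fin d) := fun v => v + γ v • ν
  have hG : LipschitzOnWith (1 + K) G t := by
    refine LipschitzOnWith.of_dist_le_mul fun v hv w hw => ?_
    have h1 := hK.dist_le_mul v hv w hw
    rw [Real.dist_eq] at h1
    rw [dist_eq_norm, NNReal.coe_add, NNReal.coe_one, add_mul, one_mul,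
      show G v - G w = ((v - w : V) : EuclideanSpace ℝ (Fin d)) + (γ v - γ w) • ν by
        simp only [G, sub_smul, Submodule.coe_sub]; abel]
    refine (norm_add_le _ _).trans (add_le_add (le_of_eq ?_) ?_)
    · rw [dist_eq_norm]; rfl
    · rwa [norm_smul, hν, mul_one, Real.norm_eq_abs]
  refine ⟨min r r', lt_min hr hr', ?_⟩
  refine ⟨(1 + K) ^ (d - 1) * (volume (Metric.ball (0 : V) 1)).toNNReal, fun x ρ hρ => ?_⟩
  rcases hρ.eq_or_lt with rfl | hρ
  · simp
  have hsub : frontier U ∩ Metric.ball p (min r r') ∩ Metric.ball x ρ ⊆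
      G '' (t ∩ Metric.ball (P x) ρ) := by
    rintro y ⟨⟨hy, hyr⟩, hyx⟩
    refine ⟨P y, ⟨hrt ?_, ?_⟩, ?_⟩
    · exact (hPn _ _).trans_lt (hyr.trans_le (min_le_right _ _))
    · exact (hPn _ _).trans_lt hyx
    · simp only [G]
      rw [← mem_graph_of_mem_frontier hγ.continuous h hy
        (Metric.ball_subset_ball (min_le_left _ _) hyr),
        ← Submodule.starProjection_unit_singleton ℝ hν y, add_comm]
      exact (Submodule.span ℝ {ν}).starProjection_add_starProjection_orthogonal y
  refine (measure_mono hsub).trans ?_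
  refine (euclideanHausdorffMeasure_image_le (hG.mono Set.inter_subset_left) (d - 1)).trans ?_
  rw [← hdim, InnerProductSpace.euclideanHausdorffMeasure_eq_volume]
  refine (mul_le_mul_right (measure_mono Set.inter_subset_right) _).trans_eq ?_
  rw [Measure.addHaar_ball_of_pos _ _ hρ, ENNReal.coe_mul,
    ENNReal.coe_toNNReal measure_ball_lt_top.ne]
  push_cast
  ring

theorem HasC1HolderBoundary.upperRegular {d : ℕ} {s : ℝ≥0}
    {U : Set (EuclideanSpace ℝ (Fin d))} (hU : HasC1HolderBoundary s U)
    (hc : IsCompact (frontier U)) :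
    UpperRegular (surfaceMeasure d) (d - 1) (frontier U) := by
  refine hc.induction_on UpperRegular.empty (fun S S' h hS' => hS'.mono h)
    (fun S S' hS hS' => hS.union hS') fun p hp => ?_
  obtain ⟨r, hr, h⟩ := hU.exists_nhds_upperRegular hp
  exact ⟨_, inter_mem_nhdsWithin _ (Metric.ball_mem_nhds p hr), h⟩

/-- A weakly singular kernel of half the dimension of an upper regular set is uniformly
integrable on it. -/
theorem exists_lintegral_rpow_le {d k : ℕ} (hk : k ≠ 0)
    {μ : Measure (EuclideanSpace ℝ (Fin d))} {S : Set (EuclideanSpace ℝ (Fin d))}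
    (hS : UpperRegular μ k S) (hfin : μ S ≠ ⊤) :
    ∃ M : ℝ≥0, ∀ x, ∫⁻ y in S, ENNReal.ofReal (‖x - y‖ ^ (-(k / 2 : ℝ))) ∂μ ≤ M := by
  obtain ⟨C, hC⟩ := hS
  have hk' : (0 : ℝ) < k := by positivity
  have hi : IntegrableOn (fun t : ℝ => t ^ (-2 : ℝ)) (Set.Ioi 1) volume :=
    integrableOn_Ioi_rpow_of_lt (by norm_num) one_pos
  have hfin2 : ∫⁻ t in Set.Ioi (1 : ℝ), ENNReal.ofReal (t ^ (-2 : ℝ)) ≠ ⊤ :=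
    (hasFiniteIntegral_iff_ofReal (by
      filter_upwards [ae_restrict_mem measurableSet_Ioi] with t ht
      exact Real.rpow_nonneg (zero_le_one.trans (le_of_lt ht)) _)).1 hi.2 |>.ne
  let I := ∫⁻ t in Set.Ioi (1 : ℝ), ENNReal.ofReal (t ^ (-2 : ℝ))
  refine ⟨(μ S + C * I).toNNReal, fun x => ?_⟩
  rw [ENNReal.coe_toNNReal (ENNReal.add_ne_top.2 ⟨hfin, ENNReal.mul_ne_top (by simp) hfin2⟩)]
  -- Layer cake: levels `t ≤ 1` contribute at most `μ S`. For `t > 1` the superlevel set lies in a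
  -- ball of radius `t^(-2/k)`, of mass at most `C * t^(-2)`, which is integrable at infinity.
  rw [lintegral_eq_lintegral_meas_lt _ (ae_of_all _ fun y => by positivity)
    (by fun_prop)]
  rw [← Set.Ioc_union_Ioi_eq_Ioi (zero_le_one (α := ℝ)),
    lintegral_union measurableSet_Ioi (Set.Ioc_disjoint_Ioi le_rfl)]
  refine add_le_add ?_ ?_
  · calc _ ≤ ∫⁻ t in Set.Ioc (0 : ℝ) 1, μ S := by
          refine lintegral_mono fun t => ?_
          exact (measure_mono (Set.subset_univ _)).trans (by simp)
      _ = μ S := by simp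
  · rw [← lintegral_const_mul' _ _ (by simp)]
    refine setLIntegral_mono' measurableSet_Ioi fun t ht => ?_
    have ht0 : (0 : ℝ) < t := zero_lt_one.trans ht
    have hsub : {y | t < ‖x - y‖ ^ (-(k / 2 : ℝ))} ⊆ Metric.ball x (t ^ (-(2 / k : ℝ))) := by
      intro y hy
      simp only [Set.mem_ofPred_eq] at hy
      rw [Metric.mem_ball, dist_comm, dist_eq_norm]
      -- At `y = x` the kernel has the default value `0`, so that point is in no superlevel set.
      have hpos : 0 < ‖x - y‖ := by
        by_contra h0
        have h0' : ‖x - y‖ = 0 := le_antisymm (not_lt.1 h0) (norm_nonneg _)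
        rw [h0', Real.zero_rpow (by simp [hk])] at hy
        exact lt_asymm ht0 hy
      have := Real.rpow_lt_rpow_of_neg ht0 hy (z := -(2 / k : ℝ)) (by simp [hk'])
      rwa [← Real.rpow_mul hpos.le, show (-(k / 2 : ℝ)) * (-(2 / k)) = 1 by field_simp,
        Real.rpow_one] at this
    calc _ ≤ μ.restrict S (Metric.ball x (t ^ (-(2 / k : ℝ)))) := measure_mono hsub
      _ = μ (S ∩ Metric.ball x (t ^ (-(2 / k : ℝ)))) := by
        rw [Measure.restrict_apply measurableSet_ball, Set.inter_comm]
      _ ≤ C * ENNReal.ofReal ((t ^ (-(2 / k : ℝ))) ^ k) := hC _ _ (by positivity)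
      _ = C * ENNReal.ofReal (t ^ (-2 : ℝ)) := by
        rw [← Real.rpow_natCast, ← Real.rpow_mul ht0.le]
        congr 3
        field_simp

/-! ### Symmetry of the capacitance matrix -/

/-- Schur's test for a pair of square integrable functions. -/
theorem integrable_prod_kernel_mul {X : Type*} [MeasurableSpace X] {μ : Measure X} [SFinite μ]
    {k : X × X → ℂ} (hk : AEStronglyMeasurable k (μ.prod μ)) {M : ℝ≥0}
    (h1 : ∀ᵐ x ∂μ, ∫⁻ y, ‖k (x, y)‖ₑ ∂μ ≤ M) (h2 : ∀ᵐ y ∂μ, ∫⁻ x, ‖k (x, y)‖ₑ ∂μ ≤ M)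
    {φ ψ : X → ℂ} (hφ : MemLp φ 2 μ) (hψ : MemLp ψ 2 μ) :
    Integrable (fun p : X × X => k p * φ p.2 * ψ p.1) (μ.prod μ) := by
  have hL2 : ∀ f : X → ℂ, MemLp f 2 μ → ∫⁻ x, ‖f x‖ₑ ^ 2 ∂μ < ⊤ := fun f hf => by
    have := lintegral_rpow_enorm_lt_top_of_eLpNorm_lt_top (by norm_num) (by norm_num) hf.2
    simpa using this
  have m1 : AEMeasurable (fun p : X × X => ‖k p‖ₑ * ‖ψ p.1‖ₑ ^ 2) (μ.prod μ) :=
    hk.enorm.mul (hψ.1.comp_fst.enorm.pow_const 2)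
  have m2 : AEMeasurable (fun p : X × X => ‖k p‖ₑ * ‖φ p.2‖ₑ ^ 2) (μ.prod μ) :=
    hk.enorm.mul (hφ.1.comp_snd.enorm.pow_const 2)
  refine ⟨(hk.mul hφ.1.comp_snd).mul hψ.1.comp_fst, ?_⟩
  -- Separating the two densities leaves two terms; in each, the variable absent from the density is
  -- integrated first, against the kernel alone.
  have hle : ∀ a b : ENNReal, a * b ≤ b ^ 2 + a ^ 2 := fun a b => by
    rcases le_total a b with h | h
    · exact (mul_le_mul_left h b).trans (by rw [← sq]; exact le_self_add)
    · exact (mul_le_mul_right h a).trans (by rw [← sq]; exact le_add_self)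
  calc ∫⁻ p, ‖k p * φ p.2 * ψ p.1‖ₑ ∂(μ.prod μ)
      ≤ ∫⁻ p, (‖k p‖ₑ * ‖ψ p.1‖ₑ ^ 2 + ‖k p‖ₑ * ‖φ p.2‖ₑ ^ 2) ∂(μ.prod μ) := by
        refine lintegral_mono fun p => ?_
        simp only [enorm_mul]
        rw [mul_assoc, ← mul_add]
        exact mul_le_mul_right (hle _ _) _
    _ = ∫⁻ p, ‖k p‖ₑ * ‖ψ p.1‖ₑ ^ 2 ∂(μ.prod μ) + ∫⁻ p, ‖k p‖ₑ * ‖φ p.2‖ₑ ^ 2 ∂(μ.prod μ) :=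
        lintegral_add_left' m1 _
    _ ≤ M * ∫⁻ x, ‖ψ x‖ₑ ^ 2 ∂μ + M * ∫⁻ x, ‖φ x‖ₑ ^ 2 ∂μ := by
        rw [lintegral_prod _ m1, lintegral_prod_symm _ m2, ← lintegral_const_mul' _ _ (by simp),
          ← lintegral_const_mul' _ _ (by simp)]
        refine add_le_add (lintegral_mono_ae ?_) (lintegral_mono_ae ?_)
        · filter_upwards [h1] with x hx
          rw [lintegral_mul_const' _ _ (by simp)]
          exact mul_le_mul_left hx _
        · filter_upwards [h2] with y hy
          rw [lintegral_mul_const' _ _ (by simp)]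
          exact mul_le_mul_left hy _
    _ < ⊤ := ENNReal.add_lt_top.2 ⟨ENNReal.mul_lt_top (by simp) (hL2 ψ hψ),
        ENNReal.mul_lt_top (by simp) (hL2 φ hφ)⟩

theorem IsQuasiperiodicGreen.measurable {d : ℕ} {Λ : Submodule ℤ (EuclideanSpace ℝ (Fin d))}
    [DiscreteTopology Λ] [Countable Λ] {α : EuclideanSpace ℝ (Fin d)}
    {g : EuclideanSpace ℝ (Fin d) → ℂ} (hg : IsQuasiperiodicGreen Λ α g) : Measurable g := by
  refine measurable_of_restrict_of_restrict_compl (isClosed_lattice Λ).measurableSet ?_ ?_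
  · have : Countable (Λ : Set (EuclideanSpace ℝ (Fin d))) := inferInstanceAs (Countable Λ)
    exact measurable_of_countable _
  · exact (continuousOn_iff_continuous_domRestrict.1 hg.continuousOn).measurable

/-- The exponent is half the boundary dimension, as `exists_lintegral_rpow_le` requires. For `d = 3`
it is the Newtonian singularity itself; for `d = 2` it dominates the logarithm. -/
theorem abs_laplaceFundamentalSolution_le {d : ℕ} (hd : d = 2 ∨ d = 3)
    {z : EuclideanSpace ℝ (Fin d)} (hz : 0 < ‖z‖) (hz1 : ‖z‖ ≤ 1) :
    |laplaceFundamentalSolution d z| ≤ 2 * ‖z‖ ^ (-((d - 1 : ℕ) / 2 : ℝ)) := by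
  have hpi := Real.pi_gt_three
  rcases hd with rfl | rfl
  · have h1 := Real.abs_log_mul_self_rpow_lt ‖z‖ (1 / 2) hz hz1 (by norm_num)
    have hp : 0 < ‖z‖ ^ (1 / 2 : ℝ) := by positivity
    rw [abs_mul, abs_of_pos hp] at h1
    norm_num at h1 ⊢
    simp only [laplaceFundamentalSolution, if_true]
    rw [Real.rpow_neg hz.le, ← div_eq_mul_inv, abs_div,
      abs_of_pos (by positivity : 0 < 2 * Real.pi)]
    refine (div_le_self (abs_nonneg _) (by linarith)).trans ?_
    rw [le_div_iff₀ hp]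
    exact h1.le
  · norm_num
    simp only [laplaceFundamentalSolution]
    have hp : 0 < 4 * Real.pi * ‖z‖ := by positivity
    rw [Real.rpow_neg_one, if_neg (by norm_num), abs_div, abs_neg, abs_one, abs_of_pos hp,
      ← div_eq_mul_inv, div_le_div_iff₀ hp hz]
    nlinarith

/-! ### The Green's kernel on the boundary and the symmetries of the capacitance matrix -/

namespace ResonatorStructure

variable {d N : ℕ} (R : ResonatorStructure d N)

theorem frontier_subset_boundary (i : Fin N) : frontier (R.D i) ⊆ R.boundary :=
  Set.subset_iUnion (fun i => frontier (R.D i)) i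

theorem boundary_subset_interior : R.boundary ⊆ interior R.Y :=
  Set.iUnion_subset fun i => frontier_subset_closure.trans (R.D_compactlyContained i)

theorem isCompact_frontier (i : Fin N) : IsCompact (frontier (R.D i)) :=
  Metric.isCompact_of_isClosed_isBounded isClosed_frontier (R.Y_bounded.subset
    ((R.frontier_subset_boundary i).trans (R.boundary_subset_interior.trans interior_subset)))

theorem isCompact_boundary : IsCompact R.boundary := isCompact_iUnion R.isCompact_frontier

theorem upperRegular_boundary : UpperRegular (surfaceMeasure d) (d - 1) R.boundary :=
  UpperRegular.iUnion fun i => (R.D_boundary i).upperRegular (R.isCompact_frontier i)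

theorem surfaceMeasure_boundary_ne_top : surfaceMeasure d R.boundary ≠ ⊤ := by
  obtain ⟨C, hC⟩ := R.upperRegular_boundary
  obtain ⟨r, hr, h⟩ := R.isCompact_boundary.isBounded.subset_ball_lt 0 0
  have := hC 0 r hr.le
  rw [Set.inter_eq_left.2 h] at this
  exact (this.trans_lt (ENNReal.mul_lt_top (by simp) (by simp))).ne

theorem surfaceMeasure_restrict_singleton (hd : d = 2 ∨ d = 3) (x : EuclideanSpace ℝ (Fin d)) :
    (surfaceMeasure d).restrict R.boundary {x} = 0 := by
  obtain ⟨C, hC⟩ := R.upperRegular_boundary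
  rw [Measure.restrict_apply (measurableSet_singleton x)]
  have hlim : Filter.Tendsto (fun ρ : ℝ => (C : ENNReal) * ENNReal.ofReal (ρ ^ (d - 1)))
      (nhdsWithin 0 (Set.Ioi 0)) (nhds 0) := by
    have h1 : Filter.Tendsto (fun ρ : ℝ => ENNReal.ofReal (ρ ^ (d - 1)))
        (nhdsWithin 0 (Set.Ioi 0)) (nhds 0) := by
      have : Continuous fun ρ : ℝ => ENNReal.ofReal (ρ ^ (d - 1)) :=
        ENNReal.continuous_ofReal.comp (continuous_pow _)
      have h2 := this.tendsto 0
      rw [zero_pow (by omega), ENNReal.ofReal_zero] at h2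
      exact h2.mono_left nhdsWithin_le_nhds
    simpa using ENNReal.Tendsto.const_mul h1 (Or.inr (by simp))
  refine le_antisymm (ge_of_tendsto hlim ?_) zero_le
  filter_upwards [self_mem_nhdsWithin] with ρ hρ
  refine (measure_mono ?_).trans (hC x ρ (le_of_lt hρ))
  rintro y ⟨rfl, hy⟩
  exact ⟨hy, Metric.mem_ball_self hρ⟩

-- An overlap of the interior of `Y` with a nontrivial translate would be open and nonempty, hence
-- of positive measure. So `g (x - y)` meets no singularity on the boundary except at `x = y`.
open scoped Pointwise in
theorem eq_of_sub_mem_lattice {x y : EuclideanSpace ℝ (Fin d)} (hx : x ∈ interior R.Y)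
    (hy : y ∈ interior R.Y) (h : x - y ∈ R.Λ) : x = y := by
  by_contra hne
  have hn : (⟨x - y, h⟩ : R.Λ) ≠ 0 := fun h0 => hne (sub_eq_zero.1 (congrArg Subtype.val h0))
  have hdis := R.Y_unitCell.aedisjoint hn
  let O := interior R.Y ∩ (fun z => z - (x - y)) ⁻¹' interior R.Y
  have hO : IsOpen O := isOpen_interior.inter (isOpen_interior.preimage (by fun_prop))
  have hxO : x ∈ O := ⟨hx, by simpa using hy⟩
  refine (hO.measure_pos volume ⟨x, hxO⟩).ne' (measure_mono_null ?_ hdis)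
  rintro z ⟨hz, hz'⟩
  refine ⟨Set.mem_vadd_set.2 ⟨z - (x - y), interior_subset hz', ?_⟩,
    Set.mem_vadd_set.2 ⟨z, interior_subset hz, zero_vadd _ _⟩⟩
  simp [Submodule.vadd_def]

theorem exists_norm_green_le (hd : d = 2 ∨ d = 3) {α : EuclideanSpace ℝ (Fin d)}
    {g : EuclideanSpace ℝ (Fin d) → ℂ} (hg : IsQuasiperiodicGreen R.Λ α g) :
    ∃ A : ℝ≥0, ∀ x ∈ R.boundary, ∀ y ∈ R.boundary, x ≠ y →
      ‖g (x - y)‖ ≤ A * (1 + ‖x - y‖ ^ (-((d - 1 : ℕ) / 2 : ℝ))) := by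
  obtain ⟨K, r, hr, hK⟩ := hg.singularity
  -- Differences at distance at least `min r 1` form a compact set off the lattice, where `g` is
  -- bounded. Below this threshold both the singular expansion and the bound on the fundamental
  -- solution apply.
  let Z := (fun p : EuclideanSpace ℝ (Fin d) × EuclideanSpace ℝ (Fin d) => p.1 - p.2) ''
    (R.boundary ×ˢ R.boundary) ∩ {z | min r 1 ≤ ‖z‖}
  have hZ : IsCompact Z :=
    ((R.isCompact_boundary.prod R.isCompact_boundary).image continuous_sub).inter_right
      (isClosed_le continuous_const continuous_norm)
  have hZc : ContinuousOn g Z := by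
    refine hg.continuousOn.mono ?_
    rintro _ ⟨⟨⟨x, y⟩, ⟨hx, hy⟩, rfl⟩, hz⟩ hmem
    have := R.eq_of_sub_mem_lattice (R.boundary_subset_interior hx)
      (R.boundary_subset_interior hy) hmem
    simp only [Set.mem_ofPred_eq] at hz
    simp only at this
    rw [this, sub_self, norm_zero] at hz
    exact absurd hz (not_le.2 (lt_min hr one_pos))
  obtain ⟨B, hB⟩ := hZ.exists_bound_of_continuousOn hZc
  refine ⟨Real.toNNReal (|K| + |B| + 2), fun x hx y hy hxy => ?_⟩
  rw [Real.coe_toNNReal _ (by positivity)]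
  have hpos : 0 < ‖x - y‖ := norm_pos_iff.2 (sub_ne_zero.2 hxy)
  have hp : 0 ≤ ‖x - y‖ ^ (-((d - 1 : ℕ) / 2 : ℝ)) := by positivity
  have hK' := le_abs_self K
  have hB' := le_abs_self B
  have hK0 := abs_nonneg K
  have hB0 := abs_nonneg B
  rcases lt_or_ge ‖x - y‖ (min r 1) with hlt | hge
  · have h1 := hK _ hpos (hlt.trans_le (min_le_left _ _))
    have h2 := abs_laplaceFundamentalSolution_le hd hpos (hlt.le.trans (min_le_right _ _))
    have h3 := norm_le_norm_sub_add (g (x - y)) ((laplaceFundamentalSolution d (x - y) : ℝ) : ℂ)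
    rw [Complex.norm_real, Real.norm_eq_abs] at h3
    nlinarith
  · have h1 := hB (x - y) ⟨⟨(x, y), ⟨hx, hy⟩, rfl⟩, hge⟩
    nlinarith

theorem exists_lintegral_green_le (hd : d = 2 ∨ d = 3) {α : EuclideanSpace ℝ (Fin d)}
    {g : EuclideanSpace ℝ (Fin d) → ℂ} (hg : IsQuasiperiodicGreen R.Λ α g) :
    ∃ M : ℝ≥0, ∀ x ∈ R.boundary, ∫⁻ y in R.boundary, ‖g (x - y)‖ₑ ∂(surfaceMeasure d) ≤ M := by
  obtain ⟨A, hA⟩ := R.exists_norm_green_le hd hg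
  obtain ⟨M, hM⟩ := exists_lintegral_rpow_le (by omega) R.upperRegular_boundary
    R.surfaceMeasure_boundary_ne_top
  have hfin := R.surfaceMeasure_boundary_ne_top
  refine ⟨A * ((surfaceMeasure d R.boundary).toNNReal + M), fun x hx => ?_⟩
  calc ∫⁻ y in R.boundary, ‖g (x - y)‖ₑ ∂(surfaceMeasure d)
      ≤ ∫⁻ y in R.boundary, A * (1 + ENNReal.ofReal (‖x - y‖ ^ (-((d - 1 : ℕ) / 2 : ℝ))))
          ∂(surfaceMeasure d) := by
        refine lintegral_mono_ae ?_
        filter_upwards [ae_restrict_mem R.isCompact_boundary.measurableSet,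
          measure_eq_zero_iff_ae_notMem.1 (R.surfaceMeasure_restrict_singleton hd x)] with y hy hxy
        rw [← ofReal_norm]
        refine (ENNReal.ofReal_le_ofReal (hA x hx y hy (Ne.symm hxy))).trans_eq ?_
        rw [ENNReal.ofReal_mul A.coe_nonneg, ENNReal.ofReal_add zero_le_one (by positivity)]
        simp
    _ = A * (surfaceMeasure d R.boundary + ∫⁻ y in R.boundary,
          ENNReal.ofReal (‖x - y‖ ^ (-((d - 1 : ℕ) / 2 : ℝ))) ∂(surfaceMeasure d)) := by
        rw [lintegral_const_mul' _ _ (by simp), lintegral_add_left measurable_const]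
        simp
    _ ≤ _ := by
        rw [ENNReal.coe_mul, ENNReal.coe_add, ENNReal.coe_toNNReal hfin]
        gcongr
        exact hM x

theorem integrable_green_pairing (hd : d = 2 ∨ d = 3) {α : EuclideanSpace ℝ (Fin d)}
    {g : EuclideanSpace ℝ (Fin d) → ℂ} (hg : IsQuasiperiodicGreen R.Λ α g)
    {φ ψ : EuclideanSpace ℝ (Fin d) → ℂ}
    (hφ : MemLp φ 2 ((surfaceMeasure d).restrict R.boundary))
    (hψ : MemLp ψ 2 ((surfaceMeasure d).restrict R.boundary)) :
    Integrable (fun p : EuclideanSpace ℝ (Fin d) × EuclideanSpace ℝ (Fin d) =>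
      g (p.1 - p.2) * φ p.2 * ψ p.1)
      (((surfaceMeasure d).restrict R.boundary).prod ((surfaceMeasure d).restrict R.boundary)) := by
  have := R.discrete
  have := R.isZLattice
  have : IsFiniteMeasure ((surfaceMeasure d).restrict R.boundary) :=
    isFiniteMeasure_restrict.2 R.surfaceMeasure_boundary_ne_top
  obtain ⟨M₁, h1⟩ := R.exists_lintegral_green_le hd hg
  -- Integrating in the first variable is the same estimate for the reflected Green's function.
  obtain ⟨M₂, h2⟩ := R.exists_lintegral_green_le hd hg.comp_neg
  refine integrable_prod_kernel_mul (k := fun p => g (p.1 - p.2)) (M := max M₁ M₂)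
    (hg.measurable.comp measurable_sub).aestronglyMeasurable ?_ ?_ hφ hψ
  · filter_upwards [ae_restrict_mem R.isCompact_boundary.measurableSet] with x hx
    exact (h1 x hx).trans (by simp)
  · filter_upwards [ae_restrict_mem R.isCompact_boundary.measurableSet] with y hy
    have := h2 y hy
    simp only [neg_sub] at this
    exact this.trans (by simp)

/-- The capacitance matrices at `a` and `-a` are transposes of each other. -/
theorem IsCapacitanceMatrix.eq_transpose {R : ResonatorStructure d N} (hd : d = 2 ∨ d = 3)
    {a : BrillouinZone R.Λ} (ha : a ≠ 0) {C C' : Matrix (Fin N) (Fin N) ℂ}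
    (hC : R.IsCapacitanceMatrix a C) (hC' : R.IsCapacitanceMatrix (-a) C') :
    C' = C.transpose := by
  obtain ⟨α, rfl, g, hg, ψ, hψ, hCψ⟩ := hC
  obtain ⟨α', hα', g', hg', ψ', hψ', hCψ'⟩ := hC'
  have := R.discrete
  have := R.isZLattice
  have hfin : IsFiniteMeasure ((surfaceMeasure d).restrict R.boundary) :=
    isFiniteMeasure_restrict.2 R.surfaceMeasure_boundary_ne_top
  have hα : -α ∉ dualLattice R.Λ := fun h =>
    ha ((QuotientAddGroup.eq_zero_iff α).2 (by simpa using (dualLattice R.Λ).neg_mem h))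
  have hsub : -α - α' ∈ dualLattice R.Λ := by
    rw [← QuotientAddGroup.mk_neg, eq_comm, QuotientAddGroup.eq] at hα'
    simpa [sub_eq_add_neg, add_comm] using (dualLattice R.Λ).neg_mem hα'
  have hgg : ∀ z, z ∉ R.Λ → g (-z) = g' z := fun z hz =>
    hg.comp_neg.eq_of_notMem R.Y_bounded R.Y_unitCell hα hsub hg' hz
  have hint : ∀ (χ : EuclideanSpace ℝ (Fin d) → ℂ) (i : Fin N),
      ∫ x in frontier (R.D i), χ x ∂(surfaceMeasure d) =
        ∫ x in R.boundary, (frontier (R.D i)).indicator (fun _ => (1 : ℂ)) x * χ x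
          ∂(surfaceMeasure d) := fun χ i => by
    have : ∀ x, (frontier (R.D i)).indicator (fun _ => (1 : ℂ)) x * χ x =
        (frontier (R.D i)).indicator χ x := fun x => by
      by_cases hx : x ∈ frontier (R.D i) <;> simp [hx]
    simp only [this]
    rw [setIntegral_indicator isClosed_frontier.measurableSet,
      Set.inter_eq_right.2 (R.frontier_subset_boundary i)]
  ext j i
  rw [Matrix.transpose_apply, hCψ', hCψ, neg_inj, hint (ψ j) i, hint (ψ' i) j]
  -- Each indicator is a single layer potential, of `ψ j` for `g` or of `ψ' i` for `g'`. Both sides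
  -- are then the same double integral, because `g (x - y) = g' (y - x)` off the null diagonal.
  calc ∫ x in R.boundary, (frontier (R.D j)).indicator (fun _ => (1 : ℂ)) x * ψ' i x
          ∂(surfaceMeasure d)
      = ∫ x in R.boundary, ∫ y in R.boundary, g (x - y) * ψ j y * ψ' i x
          ∂(surfaceMeasure d) ∂(surfaceMeasure d) := by
        refine integral_congr_ae ?_
        filter_upwards [(hψ j).2] with x hx
        rw [← hx, singleLayer, integral_mul_const]
    _ = ∫ y in R.boundary, ∫ x in R.boundary, g (x - y) * ψ j y * ψ' i x
          ∂(surfaceMeasure d) ∂(surfaceMeasure d) :=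
        integral_integral_swap (R.integrable_green_pairing hd hg (hψ j).1 (hψ' i).1)
    _ = ∫ y in R.boundary, (frontier (R.D i)).indicator (fun _ => (1 : ℂ)) y * ψ j y
          ∂(surfaceMeasure d) := by
        refine integral_congr_ae ?_
        filter_upwards [(hψ' i).2, ae_restrict_mem R.isCompact_boundary.measurableSet]
          with y hy hyb
        rw [← hy, singleLayer, ← integral_mul_const]
        refine integral_congr_ae ?_
        filter_upwards [ae_restrict_mem R.isCompact_boundary.measurableSet,
          measure_eq_zero_iff_ae_notMem.1 (R.surfaceMeasure_restrict_singleton hd y)] with x hx hxy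
        have hmem : y - x ∉ R.Λ := fun h => hxy (R.eq_of_sub_mem_lattice
          (R.boundary_subset_interior hyb) (R.boundary_subset_interior hx) h).symm
        rw [← hgg _ hmem, neg_sub]
        ring

theorem IsCapacitanceMatrix.conj {R : ResonatorStructure d N} {a : BrillouinZone R.Λ}
    {C : Matrix (Fin N) (Fin N) ℂ} (hC : R.IsCapacitanceMatrix a C) :
    R.IsCapacitanceMatrix (-a) (C.map (starRingEnd ℂ)) := by
  obtain ⟨α, rfl, g, hg, ψ, hψ, hCψ⟩ := hC
  refine ⟨-α, rfl, _, hg.conj, fun j x => starRingEnd ℂ (ψ j x), fun j => ⟨?_, ?_⟩, fun i j => ?_⟩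
  · exact (hψ j).1.star
  · filter_upwards [(hψ j).2] with x hx
    have := congrArg (starRingEnd ℂ) hx
    rw [singleLayer, ← integral_conj] at this
    simp only [map_mul] at this
    rw [singleLayer, this]
    by_cases h : x ∈ frontier (R.D j) <;> simp [h]
  · rw [Matrix.map_apply, hCψ, map_neg, integral_conj]

/-- The conjugate of `C` is a capacitance matrix at `-a`, and every such matrix is `Cᵀ`. -/
theorem IsCapacitanceMatrix.isHermitian {R : ResonatorStructure d N} (hd : d = 2 ∨ d = 3)
    {a : BrillouinZone R.Λ} (ha : a ≠ 0) {C : Matrix (Fin N) (Fin N) ℂ}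
    (hC : R.IsCapacitanceMatrix a C) : C.IsHermitian := by
  have h := congrArg Matrix.transpose (hC.eq_transpose hd ha hC.conj)
  rwa [Matrix.transpose_transpose] at h

theorem isHermitian_capacitanceMatrix (hd : d = 2 ∨ d = 3) {a : BrillouinZone R.Λ} (ha : a ≠ 0) :
    (R.capacitanceMatrix a).IsHermitian := by
  unfold capacitanceMatrix
  split_ifs with h
  · exact h.choose_spec.isHermitian hd ha
  · exact Matrix.isHermitian_zero

/-- By conjugation a capacitance matrix exists at `a` exactly when one exists at `-a`. So either
both values are the default `0`, or the transposition law holds whichever matrices were chosen. -/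
theorem capacitanceMatrix_neg (hd : d = 2 ∨ d = 3) {a : BrillouinZone R.Λ} (ha : a ≠ 0) :
    R.capacitanceMatrix (-a) = (R.capacitanceMatrix a).transpose := by
  unfold capacitanceMatrix
  by_cases h : ∃ C, R.IsCapacitanceMatrix a C
  · have h' : ∃ C, R.IsCapacitanceMatrix (-a) C := ⟨_, h.choose_spec.conj⟩
    rw [dif_pos h, dif_pos h']
    exact h.choose_spec.eq_transpose hd ha h'.choose_spec
  · have h' : ¬∃ C, R.IsCapacitanceMatrix (-a) C := fun ⟨C, hC⟩ =>
      h ⟨_, by simpa using hC.conj⟩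
    rw [dif_neg h, dif_neg h', Matrix.transpose_zero]

end ResonatorStructure

end SpaceTimeResonators

end

theorem mainTheorem3 {d N : ℕ} (hd : d = 2 ∨ d = 3) (hN : N = 1 ∨ N = 2)
    (R : SpaceTimeResonators.ResonatorStructure d N)
    (P : SpaceTimeResonators.MaterialConstants)
    (m : SpaceTimeResonators.TimeModulation N) :
    SpaceTimeResonators.Reciprocal R P m := by
  intro a
  by_cases ha : a = 0
  · rw [ha, neg_zero]
  · have ha' : -a ≠ 0 := neg_ne_zero.2 ha
    refine Set.Subset.antisymm ?_ ?_
    · exact SpaceTimeResonators.quasifrequencies_hillMatrix_subset hN R P m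
        (R.isHermitian_capacitanceMatrix hd ha) (R.capacitanceMatrix_neg hd ha)
    -- The reverse inclusion is the same one taken at `-a`.
    · refine SpaceTimeResonators.quasifrequencies_hillMatrix_subset hN R P m
        (R.isHermitian_capacitanceMatrix hd ha') ?_
      simpa using R.capacitanceMatrix_neg hd ha'
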